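/- Let $\varphi:\mathbb{R}^n\to(-\infty,\infty]$ be proper and lower semicontinuous, and let $\kappa>0$. For $s\in\mathbb{R}$ call $\varphi$ \emph{$s$-convex} if $\varphi((1-\lambda)x+\lambda y)\le(1-\lambda)\varphi(x)+\lambda\varphi(y)-\frac{s}{2}\lambda(1-\lambda)\|x-y\|^2$ for all $x,y\in\mathbb{R}^n$, $\lambda\in(0,1)$; call $\varphi$ \emph{strongly convex with modulus $\kappa$} if it is $\kappa$-convex, and \emph{weakly convex} if it is $(-\rho)$-convex for some $\rho>0$. For $\Omega\subset\mathbb{R}^m$ and $\bar z\in\Omega$, the regular normal cone is $\widehat N_\Omega(\bar z)=\{v:\limsup_{z\to\bar z,\,z\in\Omega\setminus\{\bar z\}}\langle v,z-\bar z\rangle/\|z-\bar z\|\le 0\}$ (all of $\mathbb{R}^m$ if $\bar z$ is an isolated point of $\Omega$), and the limiting normal cone $N_\Omega(\bar z)$ is the set of limits of sequences $v_k\in\widehat N_\Omega(z_k)$ with $z_k\in\Omega$, $z_k\to\bar z$. The limiting subdifferential is $\partial\varphi(x)=\{v:(v,-1)\in N_{\operatorname{epi}\varphi}(x,\varphi(x))\}$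 if $\varphi(x)<\infty$, where $\operatorname{epi}\varphi=\{(x,\alpha)\in\mathbb{R}^n\times\mathbb{R}:\alpha\ge\varphi(x)\}$, and $\partial\varphi(x)=\emptyset$ otherwise; $\operatorname{gph}\partial\varphi=\{(x,y)\in\mathbb{R}^n\times\mathbb{R}^n:y\in\partial\varphi(x)\}$. For $(x,y)\in\operatorname{gph}\partial\varphi$ and $w\in\mathbb{R}^n$, the combined and the limiting second-order subdifferentials are $$\breve\partial^2\varphi(x,y)(w)=\{z:(z,-w)\in\widehat N_{\operatorname{gph}\partial\varphi}(x,y)\},\qquad \partial^2\varphi(x,y)(w)=\{z:(z,-w)\in N_{\operatorname{gph}\partial\varphi}(x,y)\}.$$ Then the following assertions are equivalent: (i) $\varphi$ is strongly convex with modulus $\kappa$; (ii) $\varphi$ is weakly convex and $\langle z,w\rangle\ge\kappa\|w\|^2$ for all $z\in\breve\partial^2\varphi(x,y)(w)$, $(x,y)\in\operatorname{gph}\partial\varphi$, $w\in\mathbb{R}^n$; (iii) $\varphi$ is weakly convex and $\langle z,w\rangle\ge\kappa\|w\|^2$ for all $z\in\partial^2\varphi(x,y)(w)$, $(x,y)\in\operatorname{gph}\partial\varphi$,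 $w\in\mathbb{R}^n$. -/

import Mathlib

open Filter Topology Set

noncomputable section

namespace VarAnalysis

section Cones

variable {H : Type*} [NormedAddCommGroup H] [InnerProductSpace ℝ H]

/-- The (Frechet) regular normal cone to `Ω` at `z₀`: all `v` with
`limsup ⟪v, z - z₀⟫ / ‖z - z₀‖ ≤ 0` as `z → z₀`, `z ∈ Ω`, `z ≠ z₀`. The upper limit is taken in
the extended reals, so that at an isolated point of `Ω` every `v` is a regular normal.
The cone is empty at points outside `Ω`. -/
def regularNormalCone (Ω : Set H) (z₀ : H) : Set H :=
  {v | z₀ ∈ Ω ∧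
    limsup (fun z : H => ((inner ℝ v (z - z₀) / ‖z - z₀‖ : ℝ) : EReal)) (𝓝[Ω \ {z₀}] z₀) ≤ 0}

/-- The (Mordukhovich) limiting normal cone to `Ω` at `z₀`: limits of regular normals at
points of `Ω` converging to `z₀`. It is empty at points outside `Ω`. -/
def limitingNormalCone (Ω : Set H) (z₀ : H) : Set H :=
  {v | z₀ ∈ Ω ∧ ∃ (z : ℕ → H) (u : ℕ → H),
    (∀ k, z k ∈ Ω) ∧ Tendsto z atTop (𝓝 z₀) ∧ Tendsto u atTop (𝓝 v) ∧
    ∀ k, u k ∈ regularNormalCone Ω (z k)}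

/-- The epsilon form of the definition of the regular normal cone. -/
theorem mem_regularNormalCone_iff (Ω : Set H) (z₀ v : H) :
    v ∈ regularNormalCone Ω z₀ ↔
      z₀ ∈ Ω ∧ ∀ ε : ℝ, 0 < ε → ∀ᶠ z in 𝓝[Ω] z₀, inner ℝ v (z - z₀) ≤ ε * ‖z - z₀‖ := by
  unfold regularNormalCone
  simp only [mem_ofPred_eq]
  refine and_congr_right fun _ => ?_
  constructor
  · intro h ε hε
    have h1 := eventually_lt_of_limsup_lt (lt_of_le_of_lt h (EReal.coe_pos.mpr hε))
    rw [eventually_nhdsWithin_iff] at h1 ⊢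
    filter_upwards [h1] with z hz hzΩ
    by_cases hzz : z = z₀
    · simp [hzz]
    · have h2 := EReal.coe_lt_coe_iff.mp (hz ⟨hzΩ, hzz⟩)
      have h3 : 0 < ‖z - z₀‖ := norm_pos_iff.mpr (sub_ne_zero.mpr hzz)
      exact ((div_lt_iff₀ h3).mp h2).le
  · intro h
    refine EReal.le_of_forall_lt_iff_le.mp fun ε hε => ?_
    have hε' : 0 < ε := by exact_mod_cast hε
    refine limsup_le_of_le (h := ?_)
    have h1 := h ε hε'
    rw [eventually_nhdsWithin_iff] at h1 ⊢
    filter_upwards [h1] with z hz hzΩ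
    have h3 : 0 < ‖z - z₀‖ := norm_pos_iff.mpr (sub_ne_zero.mpr hzΩ.2)
    exact EReal.coe_le_coe_iff.mpr ((div_le_iff₀ h3).mpr (hz hzΩ.1))

end Cones

section Coderivatives

variable {E F : Type*} [NormedAddCommGroup E] [InnerProductSpace ℝ E]
  [NormedAddCommGroup F] [InnerProductSpace ℝ F]

/-- The graph of a multifunction, in the product space with its Euclidean (`ℓ²`) structure. -/
def graph (M : E → Set F) : Set (WithLp 2 (E × F)) := {p | p.snd ∈ M p.fst}

/-- The regular coderivative of `M` at `(x, y)`, applied to `v`. -/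
def regularCoderivative (M : E → Set F) (x : E) (y : F) (v : F) : Set E :=
  {u | WithLp.toLp 2 (u, -v) ∈ regularNormalCone (graph M) (WithLp.toLp 2 (x, y))}

/-- The limiting coderivative of `M` at `(x, y)`, applied to `v`. -/
def limitingCoderivative (M : E → Set F) (x : E) (y : F) (v : F) : Set E :=
  {u | WithLp.toLp 2 (u, -v) ∈ limitingNormalCone (graph M) (WithLp.toLp 2 (x, y))}

end Coderivatives

section Functions

variable {E : Type*} [NormedAddCommGroup E] [InnerProductSpace ℝ E]

/-- `φ` takes values in `(-∞, ∞]` and is finite somewhere. -/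
def IsProper (φ : E → EReal) : Prop := (∀ x, φ x ≠ ⊥) ∧ ∃ x, φ x ≠ ⊤

/-- The effective domain. -/
def effDom (φ : E → EReal) : Set E := {x | φ x < ⊤}

/-- The epigraph, in the product space with its Euclidean (`ℓ²`) structure. -/
def epi (φ : E → EReal) : Set (WithLp 2 (E × ℝ)) := {p | φ p.fst ≤ (p.snd : EReal)}

/-- The basic (limiting) subdifferential; it is empty outside the effective domain. -/
def subdifferential (φ : E → EReal) (x : E) : Set E :=
  {v | x ∈ effDom φ ∧
    WithLp.toLp 2 (v, (-1 : ℝ)) ∈ limitingNormalCone (epi φ) (WithLp.toLp 2 (x, (φ x).toReal))}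

/-- `s`-convexity on `Ω`, for a real number `s` of any sign. -/
def SConvexOn (s : ℝ) (Ω : Set E) (φ : E → EReal) : Prop :=
  ∀ x ∈ Ω, ∀ y ∈ Ω, ∀ t : ℝ, 0 < t → t < 1 →
    φ ((1 - t) • x + t • y) ≤
      ((1 - t : ℝ) : EReal) * φ x + (t : EReal) * φ y
        - ((s / 2 * t * (1 - t) * ‖x - y‖ ^ 2 : ℝ) : EReal)

/-- Strong convexity (on the whole space) with modulus `κ`. -/
def IsStronglyConvex (κ : ℝ) (φ : E → EReal) : Prop := 0 < κ ∧ SConvexOn κ univ φ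

/-- Weak convexity (on the whole space): `ρ`-weak convexity for some `ρ > 0`. -/
def IsWeaklyConvex (φ : E → EReal) : Prop := ∃ ρ : ℝ, 0 < ρ ∧ SConvexOn (-ρ) univ φ

/-- The combined second-order subdifferential of `φ` at `x` relative to `y`, applied to `w`. -/
def combinedSecondSubdiff (φ : E → EReal) (x y w : E) : Set E :=
  regularCoderivative (subdifferential φ) x y w

/-- The limiting second-order subdifferential of `φ` at `x` relative to `y`, applied to `w`. -/
def limitingSecondSubdiff (φ : E → EReal) (x y w : E) : Set E :=
  limitingCoderivative (subdifferential φ) x y w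

end Functions

end VarAnalysis

end

namespace VarAnalysis

/-! Strong convexity is read off the resolvent `P = (∂φ + μI)⁻¹`, which is everywhere defined as
soon as `φ + μ/2 ‖·‖²` is strongly convex (`SConvexOn.exists_resolvent`).

From (i) to (ii), a regular normal to `gph ∂φ` is tested on graph points supplied by the resolvent,
and strong monotonicity of `∂φ` yields the bound.

From (ii) to (i), gph `P` is a linear image of `gph ∂φ`, so proximal subgradients of `⟨u, P ·⟩` are
second-order subgradients of `φ`. Positivity bounds them by `‖u‖ / (κ + μ)`, and a mean value
inequality gives `SConvexOn.resolvent_lipschitz`. The Moreau envelope, with gradient `μ(p - P(μp))`,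
is then strongly convex with modulus `μκ/(κ + μ)`; letting `μ → ∞` recovers `φ` and `κ`.

(ii) and (iii) are equivalent because regular normals are limiting normals and the bound survives
limits. -/

theorem prod_norm_le_add {E F : Type*} [SeminormedAddCommGroup E]
    [SeminormedAddCommGroup F] (x : E) (y : F) :
    ‖(WithLp.toLp 2 (x, y) : WithLp 2 (E × F))‖ ≤ ‖x‖ + ‖y‖ := by
  rw [WithLp.prod_norm_eq_of_L2]
  refine Real.sqrt_le_iff.mpr ⟨by positivity, ?_⟩
  have h1 := norm_nonneg x
  have h2 := norm_nonneg y
  change ‖x‖ ^ 2 + ‖y‖ ^ 2 ≤ _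
  nlinarith [mul_nonneg h1 h2]

theorem norm_fst_le_of_L2 {E F : Type*} [SeminormedAddCommGroup E]
    [SeminormedAddCommGroup F] (p : WithLp 2 (E × F)) : ‖p.fst‖ ≤ ‖p‖ := by
  rw [WithLp.prod_norm_eq_of_L2]
  exact Real.le_sqrt_of_sq_le (by nlinarith [sq_nonneg ‖p.snd‖])

theorem norm_snd_le_of_L2 {E F : Type*} [SeminormedAddCommGroup E]
    [SeminormedAddCommGroup F] (p : WithLp 2 (E × F)) : ‖p.snd‖ ≤ ‖p‖ := by
  rw [WithLp.prod_norm_eq_of_L2]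
  exact Real.le_sqrt_of_sq_le (by nlinarith [sq_nonneg ‖p.fst‖])

/-! ### Normal cones in products. -/

section Cones

variable {E F : Type*} [NormedAddCommGroup E] [InnerProductSpace ℝ E]
  [NormedAddCommGroup F] [InnerProductSpace ℝ F]

/-- Regular normals in an `ℓ²` product, in terms of the sum of the component norms. -/
theorem mem_regularNormalCone_prod_iff (Ω : Set (WithLp 2 (E × F))) (x u : E) (y v : F) :
    WithLp.toLp 2 (u, v) ∈ regularNormalCone Ω (WithLp.toLp 2 (x, y)) ↔
      WithLp.toLp 2 (x, y) ∈ Ω ∧ ∀ ε : ℝ, 0 < ε → ∃ r : ℝ, 0 < r ∧ ∀ x' y',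
        WithLp.toLp 2 (x', y') ∈ Ω → ‖x' - x‖ < r → ‖y' - y‖ < r →
        inner ℝ u (x' - x) + inner ℝ v (y' - y) ≤ ε * (‖x' - x‖ + ‖y' - y‖) := by
  rw [mem_regularNormalCone_iff]
  refine and_congr_right fun _ => ⟨fun h ε hε => ?_, fun h ε hε => ?_⟩
  · have h1 := h ε hε
    rw [eventually_nhdsWithin_iff, Metric.eventually_nhds_iff] at h1
    obtain ⟨r, hr, h2⟩ := h1
    refine ⟨r / 2, by linarith, fun x' y' hm hx hy => ?_⟩
    have h4 := prod_norm_le_add (x' - x) (y' - y)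
    have h5 : (WithLp.toLp 2 (x', y') : WithLp 2 (E × F)) - WithLp.toLp 2 (x, y)
        = WithLp.toLp 2 (x' - x, y' - y) := rfl
    have h3 := h2 (y := WithLp.toLp 2 (x', y')) (by rw [dist_eq_norm, h5]; linarith) hm
    rw [h5, WithLp.prod_inner_apply] at h3
    exact h3.trans (by gcongr)
  · obtain ⟨r, hr, h2⟩ := h (ε / 2) (by linarith)
    rw [eventually_nhdsWithin_iff, Metric.eventually_nhds_iff]
    refine ⟨r, hr, fun p hp hm => ?_⟩
    have h3 := norm_fst_le_of_L2 (p - WithLp.toLp 2 (x, y))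
    have h4 := norm_snd_le_of_L2 (p - WithLp.toLp 2 (x, y))
    rw [dist_eq_norm] at hp
    have h5 := h2 p.fst p.snd hm (lt_of_le_of_lt h3 hp) (lt_of_le_of_lt h4 hp)
    rw [WithLp.prod_inner_apply]
    refine h5.trans ?_
    have h6 : ‖p.fst - x‖ ≤ ‖p - WithLp.toLp 2 (x, y)‖ := h3
    have h7 : ‖p.snd - y‖ ≤ ‖p - WithLp.toLp 2 (x, y)‖ := h4
    nlinarith

theorem regularNormalCone_subset_limitingNormalCone (Ω : Set E) (x : E) :
    regularNormalCone Ω x ⊆ limitingNormalCone Ω x := fun v hv =>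
  ⟨hv.1, fun _ => x, fun _ => v, fun _ => hv.1, tendsto_const_nhds, tendsto_const_nhds, fun _ => hv⟩

end Cones

/-! ### Subgradients of `s`-convex functions. -/

section Functions

theorem coe_toReal_of_mem_effDom {E : Type*} {φ : E → EReal}
    (hb : ∀ x, φ x ≠ ⊥) {x : E} (hx : x ∈ effDom φ) :
    ((φ x).toReal : EReal) = φ x :=
  EReal.coe_toReal (ne_of_lt hx) (hb x)

theorem toReal_le_of_le_coe {E : Type*} {φ : E → EReal}
    (hb : ∀ x, φ x ≠ ⊥) {x : E} {c : ℝ} (h : φ x ≤ c) :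
    x ∈ effDom φ ∧ (φ x).toReal ≤ c := by
  have hx : x ∈ effDom φ := lt_of_le_of_lt h (EReal.coe_lt_top c)
  refine ⟨hx, ?_⟩
  rw [← coe_toReal_of_mem_effDom hb hx] at h
  exact_mod_cast h

variable {E : Type*} [NormedAddCommGroup E] [InnerProductSpace ℝ E] {φ : E → EReal}

theorem SConvexOn.toReal {s : ℝ} (h : SConvexOn s univ φ) (hb : ∀ x, φ x ≠ ⊥)
    {x y : E} (hx : x ∈ effDom φ) (hy : y ∈ effDom φ) {t : ℝ} (ht0 : 0 < t) (ht1 : t < 1) :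
    (1 - t) • x + t • y ∈ effDom φ ∧ (φ ((1 - t) • x + t • y)).toReal ≤
      (1 - t) * (φ x).toReal + t * (φ y).toReal - s / 2 * t * (1 - t) * ‖x - y‖ ^ 2 := by
  refine toReal_le_of_le_coe hb ?_
  have h1 := h x (mem_univ _) y (mem_univ _) t ht0 ht1
  rw [← coe_toReal_of_mem_effDom hb hx, ← coe_toReal_of_mem_effDom hb hy] at h1
  exact_mod_cast h1

theorem sConvexOn_of_effDom {s : ℝ} (hb : ∀ x, φ x ≠ ⊥)
    (h : ∀ x ∈ effDom φ, ∀ y ∈ effDom φ, ∀ t : ℝ, 0 < t → t < 1 →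
      φ ((1 - t) • x + t • y) ≤ (((1 - t) * (φ x).toReal + t * (φ y).toReal
        - s / 2 * t * (1 - t) * ‖x - y‖ ^ 2 : ℝ) : EReal)) :
    SConvexOn s univ φ := by
  intro x _ y _ t ht0 ht1
  have hpos : (0 : ℝ) < 1 - t := by linarith
  have hbot : ∀ (a : ℝ) (z : E), 0 < a → (a : EReal) * φ z ≠ ⊥ := fun a z ha => by
    by_cases hz : z ∈ effDom φ
    · rw [← coe_toReal_of_mem_effDom hb hz, ← EReal.coe_mul]
      exact EReal.coe_ne_bot _
    · have : φ z = ⊤ := not_lt_top_iff.mp hz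
      rw [this, EReal.coe_mul_top_of_pos ha]
      simp
  by_cases hx : x ∈ effDom φ
  · by_cases hy : y ∈ effDom φ
    · have h1 := h x hx y hy t ht0 ht1
      rw [← coe_toReal_of_mem_effDom hb hx, ← coe_toReal_of_mem_effDom hb hy]
      exact_mod_cast h1
    · have hy' : φ y = ⊤ := not_lt_top_iff.mp hy
      rw [hy', EReal.coe_mul_top_of_pos ht0, EReal.add_top_of_ne_bot (hbot _ _ hpos),
        EReal.top_sub_coe]
      exact le_top
  · have hx' : φ x = ⊤ := not_lt_top_iff.mp hx
    rw [hx', EReal.coe_mul_top_of_pos hpos, EReal.top_add_of_ne_bot (hbot _ _ ht0),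
        EReal.top_sub_coe]
    exact le_top

theorem SConvexOn.mono {s s' : ℝ} (h : SConvexOn s univ φ) (hb : ∀ x, φ x ≠ ⊥) (hs : s' ≤ s) :
    SConvexOn s' univ φ := by
  refine sConvexOn_of_effDom hb fun x hx y hy t ht0 ht1 => ?_
  obtain ⟨h1, h2⟩ := h.toReal hb hx hy ht0 ht1
  rw [← coe_toReal_of_mem_effDom hb h1, EReal.coe_le_coe_iff]
  refine h2.trans ?_
  have : 0 ≤ t * (1 - t) * ‖x - y‖ ^ 2 := by
    have : 0 < 1 - t := by linarith
    positivity
  nlinarith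

/-- A proximal subgradient is a limiting subgradient. -/
theorem mem_subdifferential_of_proximal (hb : ∀ x, φ x ≠ ⊥) {x v : E} {c : ℝ}
    (hx : x ∈ effDom φ)
    (h : ∀ x' ∈ effDom φ,
      (φ x).toReal + inner ℝ v (x' - x) - c * ‖x' - x‖ ^ 2 ≤ (φ x').toReal) :
    v ∈ subdifferential φ x := by
  refine ⟨hx, regularNormalCone_subset_limitingNormalCone _ _ ?_⟩
  rw [mem_regularNormalCone_prod_iff]
  -- Within this radius the error `c‖x' - x‖²` is at most `ε‖x' - x‖`.
  refine ⟨(coe_toReal_of_mem_effDom hb hx).ge, fun ε hε => ⟨ε / (|c| + 1), by positivity,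
    fun x' a ha hx' _ => ?_⟩⟩
  obtain ⟨h1, h2⟩ := toReal_le_of_le_coe hb (show φ x' ≤ (a : EReal) from ha)
  have h3 := h x' h1
  have h4 : ‖x' - x‖ * (|c| + 1) ≤ ε := ((lt_div_iff₀ (by positivity)).mp hx').le
  have h5 : c * ‖x' - x‖ ^ 2 ≤ ε * ‖x' - x‖ := by
    have := le_abs_self c
    nlinarith [norm_nonneg (x' - x), mul_le_mul_of_nonneg_right h4 (norm_nonneg (x' - x)),
      mul_le_mul_of_nonneg_right this (sq_nonneg ‖x' - x‖)]
  have h6 : inner ℝ (-1 : ℝ) (a - (φ x).toReal) = -(a - (φ x).toReal) := by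
    simp
  rw [h6]
  nlinarith [mul_nonneg hε.le (norm_nonneg (a - (φ x).toReal))]

/-- By `s`-convexity the epigraph contains an explicit curve from `(x, a)` above the segment to
`x'`. Testing the normal on it, dividing by `t`, then letting `t → 0` and `ε → 0` gives the claim.
The result is continuous in `x`, `a`, `v`, `β`, hence passes to limiting normals. -/
theorem regular_normal_epi_inequality {s : ℝ} (h : SConvexOn s univ φ) (hb : ∀ x, φ x ≠ ⊥)
    {x v x' : E} {a β : ℝ} (hx' : x' ∈ effDom φ)
    (hv : WithLp.toLp 2 (v, β) ∈ regularNormalCone (epi φ) (WithLp.toLp 2 (x, a))) :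
    inner ℝ v (x' - x) + β * ((φ x').toReal - a - s / 2 * ‖x' - x‖ ^ 2) ≤ 0 := by
  rw [mem_regularNormalCone_prod_iff] at hv
  obtain ⟨hm, hv⟩ := hv
  obtain ⟨hx, hxa⟩ := toReal_le_of_le_coe hb (show φ x ≤ (a : EReal) from hm)
  set d := ‖x' - x‖ with hd
  set b := (φ x').toReal - a with hbdef
  have key : ∀ ε : ℝ, 0 < ε → ∀ᶠ t in 𝓝[>] (0 : ℝ),
      inner ℝ v (x' - x) + β * (b - s / 2 * (1 - t) * d ^ 2)
        ≤ ε * (d + |b - s / 2 * (1 - t) * d ^ 2|) := by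
    intro ε hε
    obtain ⟨r, hr, h1⟩ := hv ε hε
    have e1 : ∀ᶠ t in 𝓝[>] (0 : ℝ), t * d < r := by
      refine Filter.Tendsto.eventually_lt_const hr ?_
      have : Tendsto (fun t : ℝ => t * d) (𝓝 0) (𝓝 (0 * d)) := by
        apply Continuous.tendsto; fun_prop
      rw [zero_mul] at this
      exact this.mono_left nhdsWithin_le_nhds
    have e2 : ∀ᶠ t in 𝓝[>] (0 : ℝ), |t * (b - s / 2 * (1 - t) * d ^ 2)| < r := by
      refine Filter.Tendsto.eventually_lt_const hr ?_
      have : Tendsto (fun t : ℝ => |t * (b - s / 2 * (1 - t) * d ^ 2)|) (𝓝 0)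
          (𝓝 |0 * (b - s / 2 * (1 - 0) * d ^ 2)|) := by
        apply Continuous.tendsto (f := fun t : ℝ => |t * (b - s / 2 * (1 - t) * d ^ 2)|); fun_prop
      rw [zero_mul, abs_zero] at this
      exact this.mono_left nhdsWithin_le_nhds
    have e3 : ∀ᶠ t in 𝓝[>] (0 : ℝ), t < 1 :=
      (eventually_lt_nhds one_pos).filter_mono nhdsWithin_le_nhds
    filter_upwards [e1, e2, e3, self_mem_nhdsWithin] with t h2 h3 h4 (h5 : 0 < t)
    obtain ⟨h6, h7⟩ := h.toReal hb hx hx' h5 h4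
    have hxt : (1 - t) • x + t • x' - x = t • (x' - x) := by module
    have hnorm : ‖t • (x' - x)‖ = t * d := by rw [norm_smul, Real.norm_of_nonneg h5.le]
    have h8 := h1 ((1 - t) • x + t • x') (a + t * (b - s / 2 * (1 - t) * d ^ 2)) (by
        change φ ((1 - t) • x + t • x') ≤ ((a + t * (b - s / 2 * (1 - t) * d ^ 2) : ℝ) : EReal)
        rw [← coe_toReal_of_mem_effDom hb h6, EReal.coe_le_coe_iff]
        refine h7.trans ?_
        rw [norm_sub_rev x x', ← hd, hbdef]
        nlinarith) (by rwa [hxt, hnorm]) (by rwa [add_sub_cancel_left])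
    rw [hxt, hnorm, add_sub_cancel_left, Real.norm_eq_abs, abs_mul, abs_of_pos h5,
      inner_smul_right] at h8
    have h9 : inner ℝ β (t * (b - s / 2 * (1 - t) * d ^ 2))
        = t * (β * (b - s / 2 * (1 - t) * d ^ 2)) := by
      simp; ring
    rw [h9] at h8
    refine le_of_mul_le_mul_left ?_ h5
    linarith
  have key2 : ∀ ε : ℝ, 0 < ε →
      inner ℝ v (x' - x) + β * (b - s / 2 * d ^ 2) ≤ ε * (d + |b - s / 2 * d ^ 2|) := by
    intro ε hε
    have l1 : Tendsto (fun t : ℝ => inner ℝ v (x' - x) + β * (b - s / 2 * (1 - t) * d ^ 2))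
        (𝓝[>] 0) (𝓝 (inner ℝ v (x' - x) + β * (b - s / 2 * (1 - 0) * d ^ 2))) := by
      refine Tendsto.mono_left (Continuous.tendsto
        (f := fun t : ℝ => inner ℝ v (x' - x) + β * (b - s / 2 * (1 - t) * d ^ 2)) ?_ 0)
        nhdsWithin_le_nhds
      fun_prop
    have l2 : Tendsto (fun t : ℝ => ε * (d + |b - s / 2 * (1 - t) * d ^ 2|))
        (𝓝[>] 0) (𝓝 (ε * (d + |b - s / 2 * (1 - 0) * d ^ 2|))) := by
      refine Tendsto.mono_left (Continuous.tendsto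
        (f := fun t : ℝ => ε * (d + |b - s / 2 * (1 - t) * d ^ 2|)) ?_ 0)
        nhdsWithin_le_nhds
      fun_prop
    have := le_of_tendsto_of_tendsto l1 l2 (key ε hε)
    simpa using this
  have l3 : Tendsto (fun ε : ℝ => ε * (d + |b - s / 2 * d ^ 2|)) (𝓝[>] 0) (𝓝 0) := by
    have : Tendsto (fun ε : ℝ => ε * (d + |b - s / 2 * d ^ 2|)) (𝓝 0)
        (𝓝 (0 * (d + |b - s / 2 * d ^ 2|))) := by
      apply Continuous.tendsto; fun_prop
    rw [zero_mul] at this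
    exact this.mono_left nhdsWithin_le_nhds
  exact ge_of_tendsto l3 (by filter_upwards [self_mem_nhdsWithin] with ε hε using key2 ε hε)

/-- Limiting subgradients of an `s`-convex function are global `s`-subgradients. -/
theorem SConvexOn.subgradient_inequality {s : ℝ} (h : SConvexOn s univ φ) (hb : ∀ x, φ x ≠ ⊥)
    {x v x' : E} (hv : v ∈ subdifferential φ x) (hx' : x' ∈ effDom φ) :
    (φ x).toReal + inner ℝ v (x' - x) + s / 2 * ‖x' - x‖ ^ 2 ≤ (φ x').toReal := by
  obtain ⟨hx, -, z, u, hz, hzl, hul, hu⟩ := hv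
  have h1 : ∀ k, inner ℝ (u k).fst (x' - (z k).fst) + (u k).snd *
      ((φ x').toReal - (z k).snd - s / 2 * ‖x' - (z k).fst‖ ^ 2) ≤ 0 := fun k =>
    regular_normal_epi_inequality h hb hx' (hu k)
  have c1 : Tendsto (fun k => (z k).fst) atTop (𝓝 x) :=
    ((WithLp.continuous_fst 2 E ℝ).tendsto _).comp hzl
  have c2 : Tendsto (fun k => (z k).snd) atTop (𝓝 (φ x).toReal) :=
    ((WithLp.continuous_snd 2 E ℝ).tendsto _).comp hzl
  have c3 : Tendsto (fun k => (u k).fst) atTop (𝓝 v) :=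
    ((WithLp.continuous_fst 2 E ℝ).tendsto _).comp hul
  have c4 : Tendsto (fun k => (u k).snd) atTop (𝓝 (-1)) :=
    ((WithLp.continuous_snd 2 E ℝ).tendsto _).comp hul
  have c5 : Tendsto (fun k => x' - (z k).fst) atTop (𝓝 (x' - x)) := tendsto_const_nhds.sub c1
  have h2 := le_of_tendsto ((c3.inner (𝕜 := ℝ) c5).add
    (c4.mul ((c2.const_sub (φ x').toReal).sub ((c5.norm.pow 2).const_mul (s / 2)))))
    (Eventually.of_forall h1)
  linarith

theorem SConvexOn.subdifferential_monotone {s : ℝ} (h : SConvexOn s univ φ) (hb : ∀ x, φ x ≠ ⊥)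
    {x v x' v' : E} (hv : v ∈ subdifferential φ x) (hv' : v' ∈ subdifferential φ x') :
    s * ‖x' - x‖ ^ 2 ≤ inner ℝ (v' - v) (x' - x) := by
  have h1 := h.subgradient_inequality hb hv hv'.1
  have h2 := h.subgradient_inequality hb hv' hv.1
  rw [norm_sub_rev, ← neg_sub x' x, inner_neg_right] at h2
  rw [inner_sub_left]
  linarith

end Functions

end VarAnalysis

namespace VarAnalysis

/-! ### Surjectivity of the perturbed subdifferential; (i) implies (ii). -/

section Resolvent

variable {E : Type*} [NormedAddCommGroup E] [InnerProductSpace ℝ E] {φ : E → EReal}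

theorem norm_sq_convex_combination (x y : E) (t : ℝ) :
    ‖(1 - t) • x + t • y‖ ^ 2
      = (1 - t) * ‖x‖ ^ 2 + t * ‖y‖ ^ 2 - t * (1 - t) * ‖x - y‖ ^ 2 := by
  rw [norm_add_sq_real, norm_sub_sq_real, norm_smul, norm_smul, inner_smul_left, inner_smul_right,
    mul_pow, mul_pow, Real.norm_eq_abs, Real.norm_eq_abs, sq_abs, sq_abs]
  simp only [conj_trivial]
  ring

/-- A quadratic perturbation making an `s`-convex function strongly convex has a minimizer. -/
theorem SConvexOn.exists_minimizer [ProperSpace E] {s μ : ℝ} (h : SConvexOn s univ φ)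
    (hp : IsProper φ) (hl : LowerSemicontinuous φ) (hμ : 0 < s + μ) (q : E) :
    ∃ x ∈ effDom φ, ∀ x' ∈ effDom φ,
      (φ x).toReal + (μ / 2 * ‖x‖ ^ 2 - inner ℝ q x)
        ≤ (φ x').toReal + (μ / 2 * ‖x'‖ ^ 2 - inner ℝ q x') := by
  obtain ⟨hb, x₀, hx₀⟩ := hp
  have hx₀ : x₀ ∈ effDom φ := lt_top_iff_ne_top.mpr hx₀
  set g : E → ℝ := fun x => μ / 2 * ‖x‖ ^ 2 - inner ℝ q x with hg
  have hgc : Continuous g := by fun_prop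
  have hψ : LowerSemicontinuous fun x => φ x + ((g x : ℝ) : EReal) := fun x =>
    LowerSemicontinuousAt.add' (hl x) ((continuous_coe_real_ereal.comp hgc).lowerSemicontinuous x)
      (EReal.continuousAt_add (Or.inr (EReal.coe_ne_bot _)) (Or.inl (hb x)))
  have hle : ∀ {x : E} {c : ℝ}, φ x + ((g x : ℝ) : EReal) ≤ c →
      x ∈ effDom φ ∧ (φ x).toReal + g x ≤ c := by
    intro x c hxc
    have h1 : φ x ≤ ((c - g x : ℝ) : EReal) := by
      rw [EReal.coe_sub]
      exact (EReal.le_sub_iff_add_le (Or.inl (EReal.coe_ne_bot _))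
        (Or.inl (EReal.coe_ne_top _))).mpr hxc
    obtain ⟨h2, h3⟩ := toReal_le_of_le_coe hb h1
    exact ⟨h2, by linarith⟩
  have hmin : ∀ R : ℝ, 0 ≤ R → ∃ x ∈ effDom φ, ∀ x' ∈ effDom φ, ‖x' - x₀‖ ≤ R →
      (φ x).toReal + g x ≤ (φ x').toReal + g x' := by
    intro R hR
    obtain ⟨x, -, hx⟩ := (hψ.lowerSemicontinuousOn _).exists_isMinOn
      (Metric.nonempty_closedBall.mpr hR) (isCompact_closedBall x₀ R)
    have h1 : ∀ x' ∈ effDom φ, ‖x' - x₀‖ ≤ R →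
        x ∈ effDom φ ∧ (φ x).toReal + g x ≤ (φ x').toReal + g x' := by
      intro x' hx' hR'
      have h2 := hx (show x' ∈ Metric.closedBall x₀ R by rwa [mem_closedBall_iff_norm])
      simp only [mem_ofPred_eq] at h2
      rw [← coe_toReal_of_mem_effDom hb hx', ← EReal.coe_add] at h2
      exact hle h2
    exact ⟨x, (h1 x₀ hx₀ (by simpa using hR)).1, fun x' hx' hR' => (h1 x' hx' hR').2⟩
  -- Coercivity: the segment from `x₀` to a far `x'` meets the unit sphere around `x₀` at a value at
  -- least `m`. The `(s + μ)`-convexity of the sum then forces its value at `x'` to be at least `F₀`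
  -- once `r > 1 + 2(F₀ - m)/(s + μ)`.
  obtain ⟨xm, -, hm⟩ := hmin 1 zero_le_one
  set m := (φ xm).toReal + g xm
  set F₀ := (φ x₀).toReal + g x₀ with hF₀
  have hmF : m ≤ F₀ := hm x₀ hx₀ (by simp)
  have hR1 : 0 ≤ 2 * (F₀ - m) / (s + μ) := div_nonneg (by linarith) hμ.le
  obtain ⟨x, hx, hxmin⟩ := hmin (1 + 2 * (F₀ - m) / (s + μ)) (by linarith)
  refine ⟨x, hx, fun x' hx' => ?_⟩
  rcases le_or_gt ‖x' - x₀‖ (1 + 2 * (F₀ - m) / (s + μ)) with hr | hr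
  · exact hxmin x' hx' hr
  refine (hxmin x₀ hx₀ (by simp; linarith)).trans ?_
  set r := ‖x' - x₀‖ with hrdef
  have hr1 : 1 < r := by linarith
  have hr0 : 0 < r := by linarith
  have ht1 : r⁻¹ < 1 := inv_lt_one_of_one_lt₀ hr1
  obtain ⟨h1, h2⟩ := h.toReal hb hx₀ hx' (inv_pos.mpr hr0) ht1
  have h3 := hm _ h1 (by
    have : (1 - r⁻¹) • x₀ + r⁻¹ • x' - x₀ = r⁻¹ • (x' - x₀) := by module
    rw [this, norm_smul, ← hrdef, norm_inv, Real.norm_of_nonneg hr0.le, inv_mul_cancel₀ hr0.ne'])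
  have h4 : g ((1 - r⁻¹) • x₀ + r⁻¹ • x')
      = (1 - r⁻¹) * g x₀ + r⁻¹ * g x' - μ / 2 * r⁻¹ * (1 - r⁻¹) * r ^ 2 := by
    simp only [hg]
    rw [norm_sq_convex_combination, norm_sub_rev x₀ x', ← hrdef, inner_add_right, inner_smul_right,
      inner_smul_right]
    ring
  rw [h4] at h3
  rw [norm_sub_rev x₀ x', ← hrdef] at h2
  have h5 : m ≤ (1 - r⁻¹) * F₀ + r⁻¹ * ((φ x').toReal + g x')
      - (s + μ) / 2 * (r⁻¹ * (1 - r⁻¹) * r ^ 2) := by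
    rw [hF₀]; linarith
  have h6 : r⁻¹ * (1 - r⁻¹) * r ^ 2 = r - 1 := by field_simp
  rw [h6] at h5
  have h7 : 2 * (F₀ - m) < (r - 1) * (s + μ) := by
    rw [← div_lt_iff₀ hμ]; linarith
  have h8 : r⁻¹ * F₀ ≤ r⁻¹ * ((φ x').toReal + g x') := by linarith
  exact le_of_mul_le_mul_left h8 (inv_pos.mpr hr0)

/-- Surjectivity of `∂φ + μ I` for an `s`-convex function with `s + μ > 0`. -/
theorem SConvexOn.exists_resolvent [ProperSpace E] {s μ : ℝ} (h : SConvexOn s univ φ)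
    (hp : IsProper φ) (hl : LowerSemicontinuous φ) (hμ : 0 < s + μ) (q : E) :
    ∃ x, q - μ • x ∈ subdifferential φ x := by
  obtain ⟨x, hx, hmin⟩ := h.exists_minimizer hp hl hμ q
  refine ⟨x, mem_subdifferential_of_proximal (c := μ / 2) hp.1 hx fun x' hx' => ?_⟩
  have h1 := hmin x' hx'
  have h2 := norm_sub_sq_real x' x
  rw [real_inner_comm] at h2
  rw [inner_sub_left, inner_smul_left, inner_sub_right, inner_sub_right, h2,
    real_inner_self_eq_norm_sq]
  simp only [conj_trivial]
  linarith

theorem mem_combinedSecondSubdiff_iff {x y w z : E} :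
    z ∈ combinedSecondSubdiff φ x y w ↔
      y ∈ subdifferential φ x ∧ ∀ ε : ℝ, 0 < ε → ∃ r : ℝ, 0 < r ∧ ∀ x' y',
        y' ∈ subdifferential φ x' → ‖x' - x‖ < r → ‖y' - y‖ < r →
        inner ℝ z (x' - x) - inner ℝ w (y' - y) ≤ ε * (‖x' - x‖ + ‖y' - y‖) := by
  refine (mem_regularNormalCone_prod_iff (graph (subdifferential φ)) x z y (-w)).trans ?_
  simp only [inner_neg_left, ← sub_eq_add_neg]
  rfl

/-- The combined second-order subdifferential of a `κ`-convex function is `κ`-positive. -/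
theorem SConvexOn.le_inner_of_mem_combinedSecondSubdiff [ProperSpace E] {κ : ℝ}
    (h : SConvexOn κ univ φ) (hp : IsProper φ) (hl : LowerSemicontinuous φ) {x y w z : E}
    (hz : z ∈ combinedSecondSubdiff φ x y w) : κ * ‖w‖ ^ 2 ≤ inner ℝ z w := by
  obtain ⟨hy, hz⟩ := mem_combinedSecondSubdiff_iff.mp hz
  have key : ∀ δ : ℝ, 0 < δ → κ * ‖w‖ ^ 2 ≤ inner ℝ z w + δ * ‖w‖ ^ 2 := by
    intro δ hδ
    -- Any `δ > 0` makes `κ + μ = δ` positive, so the resolvent exists; `μ` itself may be negative.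
    set μ := δ - κ with hμ
    set u := z + μ • w with hu
    set C := ‖u‖ / δ + (‖u‖ + |μ| * (‖u‖ / δ)) with hC
    have hC0 : 0 ≤ C := by positivity
    have key2 : ∀ ε : ℝ, 0 < ε → -inner ℝ w u ≤ ε * C := by
      intro ε hε
      obtain ⟨r, hr, h1⟩ := hz ε hε
      set t := r / (C + 1) with ht
      have ht0 : 0 < t := by positivity
      have htC : t * C < r := by
        rw [ht, div_mul_eq_mul_div, div_lt_iff₀ (by positivity)]
        nlinarith
      -- Moving the resolvent's argument by `t • u` produces a graph point at distance `O(t)`, with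
      -- `⟨u, X - x⟩ ≥ 0` by monotonicity. The normal inequality there leaves `-⟨w, u⟩ ≤ εC`.
      obtain ⟨X, hX⟩ := h.exists_resolvent hp hl (by linarith : 0 < κ + μ) (y + μ • x + t • u)
      have hdy : y + μ • x + t • u - μ • X - y = t • u - μ • (X - x) := by module
      have h2 := h.subdifferential_monotone hp.1 hy hX
      rw [hdy, inner_sub_left, inner_smul_left, inner_smul_left, real_inner_self_eq_norm_sq] at h2
      simp only [conj_trivial] at h2
      have h3 : δ * ‖X - x‖ ^ 2 ≤ t * inner ℝ u (X - x) := by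
        rw [hμ] at h2; linarith
      have h4 : 0 ≤ inner ℝ u (X - x) := by
        have : 0 ≤ t * inner ℝ u (X - x) := le_trans (by positivity) h3
        exact nonneg_of_mul_nonneg_right this ht0
      have h5 : ‖X - x‖ ≤ t * (‖u‖ / δ) := by
        rw [← mul_div_assoc, le_div_iff₀ hδ]
        rcases (norm_nonneg (X - x)).eq_or_lt with h0 | h0
        · rw [← h0]; simp; positivity
        · have := real_inner_le_norm u (X - x)
          refine le_of_mul_le_mul_right ?_ h0
          nlinarith
      have h6 : ‖t • u - μ • (X - x)‖ ≤ t * (‖u‖ + |μ| * (‖u‖ / δ)) := by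
        refine (norm_sub_le _ _).trans ?_
        rw [norm_smul, norm_smul, Real.norm_of_nonneg ht0.le, Real.norm_eq_abs]
        nlinarith [mul_le_mul_of_nonneg_left h5 (abs_nonneg μ)]
      have h7 : ‖X - x‖ + ‖t • u - μ • (X - x)‖ ≤ t * C := by rw [hC]; linarith
      have h8 := h1 X _ hX (by linarith [norm_nonneg (t • u - μ • (X - x))])
        (by rw [hdy]; linarith [norm_nonneg (X - x)])
      rw [hdy] at h8
      have h9 : inner ℝ z (X - x) - inner ℝ w (t • u - μ • (X - x))
          = inner ℝ u (X - x) - t * inner ℝ w u := by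
        rw [hu, inner_sub_right (𝕜 := ℝ) w, inner_smul_right, inner_smul_right, inner_add_left (𝕜 := ℝ) z,
          inner_smul_left]
        simp only [conj_trivial]
        ring
      rw [h9] at h8
      refine le_of_mul_le_mul_left ?_ ht0
      nlinarith [mul_le_mul_of_nonneg_left h7 hε.le]
    have h1 : -inner ℝ w u ≤ 0 := by
      refine le_of_forall_pos_le_add fun ε hε => ?_
      refine (key2 (ε / (C + 1)) (by positivity)).trans ?_
      rw [div_mul_eq_mul_div, div_le_iff₀ (by positivity)]
      nlinarith
    rw [hu, inner_add_right, inner_smul_right, real_inner_self_eq_norm_sq, real_inner_comm] at h1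
    rw [hμ] at h1
    linarith
  refine le_of_forall_pos_le_add fun ε hε => ?_
  refine (key (ε / (‖w‖ ^ 2 + 1)) (by positivity)).trans ?_
  gcongr
  rw [div_mul_eq_mul_div, div_le_iff₀ (by positivity)]
  nlinarith

end Resolvent

/-! ### A mean value inequality and a convexity criterion. -/

section MeanValue

variable {E : Type*} [NormedAddCommGroup E] [InnerProductSpace ℝ E]

/-- A Lipschitz function whose proximal subgradients are bounded by `L` is `L`-Lipschitz. -/
theorem sub_le_of_proximal_subgradient_le [ProperSpace E] {f : E → ℝ} {K L : ℝ}
    (hf : Continuous f) (hK : ∀ a b, f b - f a ≤ K * ‖a - b‖)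
    (h : ∀ (q v : E) (c : ℝ), 0 ≤ c →
      (∀ q', f q + inner ℝ v (q' - q) - c * ‖q' - q‖ ^ 2 ≤ f q') → ‖v‖ ≤ L)
    (a b : E) (hL : 0 ≤ L) : f b - f a ≤ L * ‖a - b‖ := by
  have key : ∀ ε : ℝ, 0 < ε → f b ≤ f a + (L + ε) * ‖a - b‖ + ε * ‖a - b‖ ^ 2 := by
    intro ε hε
    obtain ⟨q, hq⟩ := Continuous.exists_forall_le'
      (f := fun q => f q + (L + ε) * ‖q - b‖ + ε * ‖q - b‖ ^ 2) (by fun_prop) b (by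
        filter_upwards [(tendsto_dist_right_cocompact_atTop b).eventually_ge_atTop (K / ε)]
          with q hq
        rw [dist_eq_norm, div_le_iff₀ hε] at hq
        simp only [sub_self, norm_zero]
        have h1 := hK q b
        have h2 := norm_nonneg (q - b)
        have h3 : 0 ≤ (L + ε) * ‖q - b‖ := by positivity
        nlinarith [mul_le_mul_of_nonneg_right hq h2])
    -- A minimizer at `b`, compared with `a`, is the claim. Elsewhere the penalty would create a
    -- proximal subgradient of norm greater than `L`.
    by_cases hqb : q = b
    · have := hq a
      simpa [hqb] using this
    exfalso
    set r := ‖q - b‖ with hr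
    have hr0 : 0 < r := norm_pos_iff.mpr (sub_ne_zero.mpr hqb)
    -- The norm is majorized by `(‖q' - b‖² + r²) / (2r)`, with equality at `q`; `c` is the total
    -- quadratic coefficient of the majorized penalty.
    set c := (L + ε) / (2 * r) + ε with hc
    have hc0 : 0 ≤ c := by positivity
    have hcr : c * (2 * r) = L + ε + 2 * ε * r := by rw [hc]; field_simp
    have h1 : ‖(-(2 * c)) • (q - b)‖ ≤ L := by
      refine h q _ c hc0 fun q' => ?_
      have h2 := hq q'
      have h3 : ‖q' - b‖ ^ 2 = ‖q' - q‖ ^ 2 + 2 * inner ℝ (q - b) (q' - q) + r ^ 2 := by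
        rw [hr, real_inner_comm, ← norm_add_sq_real, sub_add_sub_cancel]
      have h4 : (L + ε) * ‖q' - b‖ ≤ (L + ε) / (2 * r) * (‖q' - b‖ ^ 2 + r ^ 2) := by
        rw [div_mul_eq_mul_div, le_div_iff₀ (by positivity)]
        have : 0 < L + ε := by positivity
        nlinarith [mul_nonneg this.le (sq_nonneg (‖q' - b‖ - r))]
      have h5 : (L + ε) / (2 * r) * r ^ 2 * 2 = (L + ε) * r := by field_simp
      rw [inner_smul_left]
      simp only [conj_trivial]
      have h6 : c * ‖q' - b‖ ^ 2 = c * ‖q' - q‖ ^ 2 + 2 * c * inner ℝ (q - b) (q' - q) + c * r ^ 2 := by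
        rw [h3]; ring
      have h7 : c * r ^ 2 = (L + ε) / (2 * r) * r ^ 2 + ε * r ^ 2 := by rw [hc]; ring
      have h8 : c * ‖q' - b‖ ^ 2 = (L + ε) / (2 * r) * ‖q' - b‖ ^ 2 + ε * ‖q' - b‖ ^ 2 := by
        rw [hc]; ring
      linarith
    rw [norm_smul, norm_neg, Real.norm_of_nonneg (by positivity), ← hr] at h1
    have : 0 < 2 * ε * r := by positivity
    linarith
  rw [sub_le_iff_le_add]
  refine le_of_forall_pos_le_add fun ε hε => ?_
  have hd : 0 < ‖a - b‖ + ‖a - b‖ ^ 2 + 1 := by positivity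
  refine (key (ε / (‖a - b‖ + ‖a - b‖ ^ 2 + 1)) (by positivity)).trans ?_
  have : ε / (‖a - b‖ + ‖a - b‖ ^ 2 + 1) * (‖a - b‖ + ‖a - b‖ ^ 2) ≤ ε := by
    rw [div_mul_eq_mul_div, div_le_iff₀ hd]
    nlinarith
  linarith

/-- A function on the line with monotone "gradient" `g` and a quadratic upper model is convex. -/
theorem convexOn_of_quadratic_upper_bound {θ g : ℝ → ℝ} {a : ℝ}
    (hup : ∀ t t', θ t' ≤ θ t + g t * (t' - t) + a * (t' - t) ^ 2) (hg : Monotone g) :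
    ConvexOn ℝ univ θ := by
  have hderiv : ∀ t, HasDerivAt θ (g t) t := by
    intro t
    rw [hasDerivAt_iff_isLittleO]
    refine Asymptotics.IsBigO.trans_isLittleO (g := fun t' => (t' - t) ^ 2) ?_ ?_
    -- The upper model based at `t'`, combined with monotonicity of `g`, supplies the matching lower
    -- bound at `t`.
    · refine Asymptotics.IsBigO.of_bound |a| (Eventually.of_forall fun t' => ?_)
      have h1 := hup t t'
      have h2 := hup t' t
      have h3 : 0 ≤ (g t' - g t) * (t' - t) := by
        rcases le_total t t' with h | h
        · exact mul_nonneg (sub_nonneg.mpr (hg h)) (sub_nonneg.mpr h)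
        · exact mul_nonneg_of_nonpos_of_nonpos (sub_nonpos.mpr (hg h)) (sub_nonpos.mpr h)
      have h4 := mul_le_mul_of_nonneg_right (le_abs_self a) (sq_nonneg (t' - t))
      rw [Real.norm_eq_abs, Real.norm_of_nonneg (sq_nonneg (t' - t)), abs_le, smul_eq_mul]
      constructor <;> nlinarith
    · have := Asymptotics.isLittleO_pow_sub_sub t (m := 2) one_lt_two
      simpa using this
  refine Monotone.convexOn_univ_of_deriv (fun t => (hderiv t).differentiableAt) ?_
  have : deriv θ = g := funext fun t => (hderiv t).deriv
  rwa [this]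

/-- Along the line through `x` and `y`, subtracting `k/2 τ²‖d‖²` reduces to the one-dimensional
criterion; differentiability is a consequence of the two bounds. -/
theorem strongly_convex_of_quadratic_upper_bound {e : E → ℝ} {G : E → E} {a k : ℝ}
    (hup : ∀ p p', e p' ≤ e p + inner ℝ (G p) (p' - p) + a * ‖p' - p‖ ^ 2)
    (hG : ∀ p p', k * ‖p' - p‖ ^ 2 ≤ inner ℝ (G p' - G p) (p' - p))
    (x y : E) {t : ℝ} (ht0 : 0 < t) (ht1 : t < 1) :
    e ((1 - t) • x + t • y) ≤ (1 - t) * e x + t * e y - k / 2 * t * (1 - t) * ‖x - y‖ ^ 2 := by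
  set d := y - x with hd
  have hdiff : ∀ τ τ' : ℝ, x + τ' • d - (x + τ • d) = (τ' - τ) • d := fun τ τ' => by module
  have hconv := convexOn_of_quadratic_upper_bound
    (θ := fun τ => e (x + τ • d) - k / 2 * τ ^ 2 * ‖d‖ ^ 2)
    (g := fun τ => inner ℝ (G (x + τ • d)) d - k * τ * ‖d‖ ^ 2)
    (a := (a - k / 2) * ‖d‖ ^ 2)
    (fun τ τ' => by
      have h1 := hup (x + τ • d) (x + τ' • d)
      rw [hdiff, inner_smul_right, norm_smul, mul_pow, Real.norm_eq_abs, sq_abs] at h1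
      linarith)
    (fun τ τ' hτ => by
      rcases hτ.eq_or_lt with rfl | hτ
      · rfl
      have h1 := hG (x + τ • d) (x + τ' • d)
      rw [hdiff, inner_smul_right, norm_smul, mul_pow, Real.norm_eq_abs, sq_abs,
        inner_sub_left] at h1
      have h2 : 0 < τ' - τ := sub_pos.mpr hτ
      have h3 : k * (τ' - τ) * ‖d‖ ^ 2
          ≤ inner ℝ (G (x + τ' • d)) d - inner ℝ (G (x + τ • d)) d := by
        refine le_of_mul_le_mul_left ?_ h2
        linarith
      simp only
      linarith)
  have h1 := hconv.2 (mem_univ 0) (mem_univ 1) (sub_nonneg.mpr ht1.le) ht0.le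
    (sub_add_cancel 1 t)
  simp only [smul_eq_mul, mul_zero, mul_one, zero_add, zero_smul, add_zero, one_smul] at h1
  have h2 : x + t • d = (1 - t) • x + t • y := by rw [hd]; module
  have h3 : x + d = y := by rw [hd]; abel
  rw [h2, h3] at h1
  rw [norm_sub_rev, ← hd]
  linarith

end MeanValue

end VarAnalysis

namespace VarAnalysis

/-! ### Resolvent, Moreau envelope and the passage back to `φ`. -/

section Main

variable {E : Type*} [NormedAddCommGroup E] [InnerProductSpace ℝ E] {φ : E → EReal}

/-- Positivity of the combined second-order subdifferential makes the resolvent a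
`1 / (κ + μ)`-Lipschitz map. -/
theorem SConvexOn.resolvent_lipschitz [ProperSpace E] {ρ κ μ : ℝ} (h : SConvexOn (-ρ) univ φ)
    (hb : ∀ x, φ x ≠ ⊥) (hκ : 0 < κ) (hρ : 0 < ρ) (hμ : ρ < μ)
    (hpos : ∀ x y : E, y ∈ subdifferential φ x → ∀ w : E, ∀ z ∈ combinedSecondSubdiff φ x y w,
      κ * ‖w‖ ^ 2 ≤ inner ℝ z w)
    {P : E → E} (hP : ∀ q, q - μ • P q ∈ subdifferential φ (P q)) (q q' : E) :
    (κ + μ) * ‖P q' - P q‖ ≤ ‖q' - q‖ := by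
  have hμρ : 0 < μ - ρ := sub_pos.mpr hμ
  have hκμ : 0 < κ + μ := by linarith
  -- Weak convexity alone gives the crude constant `(μ - ρ)⁻¹`, enough for continuity and for the
  -- mean value inequality.
  have hmono : ∀ {x y x' y' : E}, y ∈ subdifferential φ x → y' ∈ subdifferential φ x' →
      (μ - ρ) * ‖x' - x‖ ≤ ‖(y' + μ • x') - (y + μ • x)‖ := by
    intro x y x' y' hy hy'
    have h1 := h.subdifferential_monotone hb hy hy'
    rcases (norm_nonneg (x' - x)).eq_or_lt with h0 | h0
    · rw [← h0]; simp
    have h2 := real_inner_le_norm ((y' + μ • x') - (y + μ • x)) (x' - x)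
    have h3 : (y' + μ • x') - (y + μ • x) = (y' - y) + μ • (x' - x) := by module
    rw [h3, inner_add_left, inner_smul_left, real_inner_self_eq_norm_sq] at h2
    simp only [conj_trivial] at h2
    rw [h3]
    refine le_of_mul_le_mul_right ?_ h0
    nlinarith
  have hPinv : ∀ {x y : E}, y ∈ subdifferential φ x → P (y + μ • x) = x := by
    intro x y hy
    have h1 := hmono hy (hP (y + μ • x))
    rw [sub_add_cancel, sub_self, norm_zero] at h1
    have h2 : ‖P (y + μ • x) - x‖ ≤ 0 := by
      refine le_of_mul_le_mul_left ?_ hμρ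
      rwa [mul_zero]
    exact sub_eq_zero.mp (norm_le_zero_iff.mp h2)
  have hPL : ∀ a b : E, ‖P b - P a‖ ≤ (μ - ρ)⁻¹ * ‖b - a‖ := by
    intro a b
    have h1 := hmono (hP a) (hP b)
    rw [sub_add_cancel, sub_add_cancel] at h1
    rwa [← div_eq_inv_mul, le_div_iff₀ hμρ, mul_comm]
  have hPc : Continuous P := by
    refine (LipschitzWith.of_dist_le_mul (K := ⟨(μ - ρ)⁻¹, by positivity⟩) fun a b => ?_).continuous
    rw [dist_eq_norm, dist_eq_norm]
    exact hPL b a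
  have hprox : ∀ (u a v : E) (c : ℝ), 0 ≤ c →
      (∀ a', inner ℝ u (P a) + inner ℝ v (a' - a) - c * ‖a' - a‖ ^ 2 ≤ inner ℝ u (P a')) →
      ‖v‖ ≤ ‖u‖ / (κ + μ) := by
    intro u a v c hc hv
    -- Substituting `a' = y' + μ • x'`, `P a' = x'` turns the proximal inequality into regular
    -- normality of `(μv - u, v)` to `gph ∂φ`. Positivity then reads `(κ + μ)‖v‖² ≤ ⟨u, v⟩`.
    have hmem : μ • v - u ∈ combinedSecondSubdiff φ (P a) (a - μ • P a) (-v) := by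
      refine mem_combinedSecondSubdiff_iff.mpr ⟨hP a, fun ε hε => ?_⟩
      set M := c * (1 + μ) ^ 2 with hM
      refine ⟨ε / (2 * (M + 1)), by positivity, fun x' y' hy' hx hy => ?_⟩
      have h1 := hv (y' + μ • x')
      rw [hPinv hy'] at h1
      have h2 : y' + μ • x' - a = (y' - (a - μ • P a)) + μ • (x' - P a) := by module
      rw [h2, inner_add_right, inner_smul_right] at h1
      have h3 : inner ℝ (μ • v - u) (x' - P a) - inner ℝ (-v) (y' - (a - μ • P a))
          = inner ℝ v (y' - (a - μ • P a)) + μ * inner ℝ v (x' - P a)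
            - (inner ℝ u x' - inner ℝ u (P a)) := by
        rw [inner_sub_left, inner_smul_left, inner_neg_left, inner_sub_right u]
        simp only [conj_trivial]
        ring
      set A := ‖x' - P a‖ with hA
      set B := ‖y' - (a - μ • P a)‖ with hB
      have hA0 : 0 ≤ A := norm_nonneg _
      have hB0 : 0 ≤ B := norm_nonneg _
      have h4 : ‖(y' - (a - μ • P a)) + μ • (x' - P a)‖ ≤ (1 + μ) * (A + B) := by
        refine (norm_add_le _ _).trans ?_
        rw [norm_smul, Real.norm_of_nonneg (by linarith), ← hA, ← hB]
        nlinarith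
      have h5 : c * ‖(y' - (a - μ • P a)) + μ • (x' - P a)‖ ^ 2 ≤ M * (A + B) ^ 2 := by
        rw [hM, mul_assoc, ← mul_pow]
        gcongr
      have hM0 : 0 ≤ M := by positivity
      have h6 : (A + B) * (M + 1) ≤ ε := by
        have : A + B < ε / (M + 1) := by
          have : ε / (M + 1) = ε / (2 * (M + 1)) + ε / (2 * (M + 1)) := by field_simp; ring
          linarith
        exact ((lt_div_iff₀ (by positivity)).mp this).le
      rw [h3]
      nlinarith [mul_le_mul_of_nonneg_right h6 (add_nonneg hA0 hB0), sq_nonneg (A + B)]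
    have h1 := hpos _ _ (hP a) _ _ hmem
    rw [norm_neg, inner_neg_right, inner_sub_left, inner_smul_left,
      real_inner_self_eq_norm_sq] at h1
    simp only [conj_trivial] at h1
    rw [le_div_iff₀ hκμ]
    rcases (norm_nonneg v).eq_or_lt with h0 | h0
    · rw [← h0]; simp
    have h2 := real_inner_le_norm u v
    refine le_of_mul_le_mul_right ?_ h0
    nlinarith
  -- With this direction the increment of `⟨u, P ·⟩` is exactly `‖u‖²`.
  set u := P q' - P q with hu
  have h1 := sub_le_of_proximal_subgradient_le (f := fun a => inner ℝ u (P a))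
    (K := ‖u‖ * (μ - ρ)⁻¹) (L := ‖u‖ / (κ + μ)) (by fun_prop) (fun a b => by
      rw [← inner_sub_right, mul_assoc, norm_sub_rev a b]
      exact (real_inner_le_norm _ _).trans (mul_le_mul_of_nonneg_left (hPL a b) (norm_nonneg u)))
    (hprox u) q q' (by positivity)
  rw [← inner_sub_right, ← hu, real_inner_self_eq_norm_sq, div_mul_eq_mul_div, le_div_iff₀ hκμ,
    norm_sub_rev q q'] at h1
  rcases (norm_nonneg u).eq_or_lt with h0 | h0
  · rw [← h0]; simp
  refine le_of_mul_le_mul_left ?_ h0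
  linarith

/-- The Moreau envelope, expressed through a selection `P` of the resolvent of `∂φ`. -/
noncomputable def envelope (φ : E → EReal) (μ : ℝ) (P : E → E) (p : E) : ℝ :=
  (φ (P (μ • p))).toReal + μ / 2 * ‖P (μ • p) - p‖ ^ 2

/-- The subgradient `μ(p - X)` at `X = P(μp)` completes the square, leaving the surplus `(μ - ρ)/2
‖x - X‖² ≥ 0`; so `X` is the proximal point of `p`. -/
theorem SConvexOn.envelope_le {ρ μ : ℝ} (h : SConvexOn (-ρ) univ φ)
    (hb : ∀ x, φ x ≠ ⊥) (hμ : ρ < μ) {P : E → E}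
    (hP : ∀ q, q - μ • P q ∈ subdifferential φ (P q)) (p : E) {x : E} (hx : x ∈ effDom φ) :
    envelope φ μ P p ≤ (φ x).toReal + μ / 2 * ‖x - p‖ ^ 2 := by
  have h1 := h.subgradient_inequality hb (hP (μ • p)) hx
  unfold envelope
  set X := P (μ • p)
  have h2 : ‖x - p‖ ^ 2 = ‖x - X‖ ^ 2 + 2 * inner ℝ (x - X) (X - p) + ‖X - p‖ ^ 2 := by
    rw [← norm_add_sq_real, sub_add_sub_cancel]
  have h3 : μ • p - μ • X = (-μ) • (X - p) := by module
  rw [h3, inner_smul_left, real_inner_comm] at h1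
  simp only [conj_trivial] at h1
  rw [h2]
  nlinarith [mul_nonneg (sub_pos.mpr hμ).le (sq_nonneg ‖x - X‖)]

/-- The proximal point of `p`, used as competitor at `p'`, gives the quadratic upper bound. Since `p
↦ P(μp)` is `μ/(κ + μ)`-Lipschitz, the gradient is strongly monotone with constant `μ(1 - μ/(κ + μ))
= μκ/(κ + μ)`. -/
theorem envelope_strongly_convex [ProperSpace E] {ρ κ μ : ℝ} (h : SConvexOn (-ρ) univ φ)
    (hb : ∀ x, φ x ≠ ⊥) (hκ : 0 < κ) (hρ : 0 < ρ) (hμ : ρ < μ)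
    (hpos : ∀ x y : E, y ∈ subdifferential φ x → ∀ w : E, ∀ z ∈ combinedSecondSubdiff φ x y w,
      κ * ‖w‖ ^ 2 ≤ inner ℝ z w)
    {P : E → E} (hP : ∀ q, q - μ • P q ∈ subdifferential φ (P q))
    (x y : E) {t : ℝ} (ht0 : 0 < t) (ht1 : t < 1) :
    envelope φ μ P ((1 - t) • x + t • y) ≤ (1 - t) * envelope φ μ P x + t * envelope φ μ P y
      - (μ * κ / (κ + μ)) / 2 * t * (1 - t) * ‖x - y‖ ^ 2 := by
  have hμ0 : 0 < μ := hρ.trans hμ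
  have hκμ : 0 < κ + μ := by linarith
  refine strongly_convex_of_quadratic_upper_bound (a := μ / 2)
    (G := fun p => μ • (p - P (μ • p))) (fun p p' => ?_) (fun p p' => ?_) x y ht0 ht1
  · refine (h.envelope_le hb hμ hP p' (hP (μ • p)).1).trans_eq ?_
    unfold envelope
    set X := P (μ • p)
    have h2 : ‖X - p'‖ ^ 2 = ‖X - p‖ ^ 2 - 2 * inner ℝ (X - p) (p' - p) + ‖p' - p‖ ^ 2 := by
      rw [← norm_sub_sq_real, sub_sub_sub_cancel_right]
    rw [h2, inner_smul_left, ← neg_sub X p, inner_neg_left]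
    simp only [conj_trivial]
    ring
  · have h1 := h.resolvent_lipschitz hb hκ hρ hμ hpos hP (μ • p) (μ • p')
    rw [← smul_sub, norm_smul, Real.norm_of_nonneg hμ0.le] at h1
    have h2 : μ • (p' - P (μ • p')) - μ • (p - P (μ • p))
        = μ • ((p' - p) - (P (μ • p') - P (μ • p))) := by module
    rw [h2, inner_smul_left, inner_sub_left, real_inner_self_eq_norm_sq]
    simp only [conj_trivial]
    have h3 := real_inner_le_norm (P (μ • p') - P (μ • p)) (p' - p)
    rw [div_mul_eq_mul_div, div_le_iff₀ hκμ]
    have h4 : (κ + μ) * inner ℝ (P (μ • p') - P (μ • p)) (p' - p) ≤ μ * ‖p' - p‖ ^ 2 := by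
      nlinarith [mul_le_mul_of_nonneg_right h1 (norm_nonneg (p' - p)),
        mul_le_mul_of_nonneg_left h3 hκμ.le]
    nlinarith [mul_le_mul_of_nonneg_left h4 hμ0.le]

/-- The Moreau envelopes exceed every number below the value of the function. -/
theorem SConvexOn.eventually_lt_envelope {ρ : ℝ} (h : SConvexOn (-ρ) univ φ)
    (hb : ∀ x, φ x ≠ ⊥) (hl : LowerSemicontinuous φ) {P : ℝ → E → E}
    (hP : ∀ μ, ρ < μ → ∀ q, q - μ • P μ q ∈ subdifferential φ (P μ q)) (p : E) {c : ℝ}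
    (hc : (c : EReal) < φ p) : ∀ᶠ μ in atTop, c < envelope φ μ (P μ) p := by
  obtain ⟨r, hr, hball⟩ := Metric.eventually_nhds_iff.mp (hl p c hc)
  set μ₀ := |ρ| + 1
  have hμ₀ : ρ < μ₀ := by linarith [le_abs_self ρ]
  have hμ₀' : 0 < μ₀ := by positivity
  -- If `X` is within `r` of `p`, lower semicontinuity suffices. Otherwise the envelope is at least
  -- `m + (μ - μ₀)/2 r²`, which exceeds `c` for large `μ`.
  set m := envelope φ μ₀ (P μ₀) p
  filter_upwards [eventually_gt_atTop μ₀, eventually_gt_atTop (μ₀ + 2 * (c - m) / r ^ 2)]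
    with μ h1 h2
  have hX := (hP μ (hμ₀.trans h1) (μ • p)).1
  have h3 := h.envelope_le hb hμ₀ (hP μ₀ hμ₀) p hX
  unfold envelope
  set X := P μ (μ • p)
  rcases lt_or_ge ‖X - p‖ r with h4 | h4
  · have h5 : (c : EReal) < φ X := hball (by rwa [dist_eq_norm])
    rw [← coe_toReal_of_mem_effDom hb hX] at h5
    have h6 : c < (φ X).toReal := by exact_mod_cast h5
    have : 0 < μ := hμ₀'.trans h1
    have : 0 ≤ μ / 2 * ‖X - p‖ ^ 2 := by positivity
    linarith
  · have h5 : 2 * (c - m) < (μ - μ₀) * r ^ 2 := by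
      rw [← div_lt_iff₀ (by positivity)]; linarith
    have h6 : r ^ 2 ≤ ‖X - p‖ ^ 2 := by gcongr
    nlinarith [mul_le_mul_of_nonneg_left h6 (sub_pos.mpr h1).le]

/-- A weakly convex function with `κ`-positive combined second-order subdifferential is
`κ`-convex. -/
theorem sConvexOn_of_combinedSecondSubdiff [ProperSpace E] {κ : ℝ} (hκ : 0 < κ)
    (hw : IsWeaklyConvex φ) (hp : IsProper φ) (hl : LowerSemicontinuous φ)
    (hpos : ∀ x y : E, y ∈ subdifferential φ x → ∀ w : E, ∀ z ∈ combinedSecondSubdiff φ x y w,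
      κ * ‖w‖ ^ 2 ≤ inner ℝ z w) :
    SConvexOn κ univ φ := by
  obtain ⟨ρ, hρ, h⟩ := hw
  have hb := hp.1
  -- The value for `μ ≤ ρ` is arbitrary; it only makes the family total in `μ`.
  have hex : ∀ μ q, ∃ x, ρ < μ → q - μ • x ∈ subdifferential φ x := fun μ q => by
    by_cases hμ : ρ < μ
    · obtain ⟨x, hx⟩ := h.exists_resolvent hp hl (by linarith : 0 < -ρ + μ) q
      exact ⟨x, fun _ => hx⟩
    · exact ⟨0, fun h => absurd h hμ⟩
  choose P hP using hex
  refine sConvexOn_of_effDom hb fun x hx y hy t ht0 ht1 => ?_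
  -- Testing against reals `c` below the value of `φ` avoids having to know that this value is
  -- finite.
  refine EReal.ge_of_forall_gt_iff_ge.mp fun c hc => EReal.coe_le_coe_iff.mpr ?_
  have hlim : Tendsto (fun μ : ℝ => μ * κ / (κ + μ)) atTop (𝓝 κ) := by
    have h1 : Tendsto (fun μ : ℝ => κ - κ ^ 2 / (κ + μ)) atTop (𝓝 (κ - 0)) :=
      tendsto_const_nhds.sub
        ((tendsto_atTop_add_const_left atTop κ tendsto_id).const_div_atTop (κ ^ 2))
    rw [sub_zero] at h1
    refine h1.congr' ?_
    filter_upwards [eventually_gt_atTop 0] with μ hμ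
    have : 0 < κ + μ := by linarith
    field_simp
    ring
  have hlim2 := (((((hlim.div_const 2).mul_const t).mul_const (1 - t)).mul_const
    (‖x - y‖ ^ 2)).const_sub ((1 - t) * (φ x).toReal + t * (φ y).toReal))
  refine ge_of_tendsto hlim2 ?_
  filter_upwards [eventually_gt_atTop ρ,
    h.eventually_lt_envelope hb hl (fun μ hμ q => hP μ q hμ) _ hc] with μ hμ hcμ
  have h1 := envelope_strongly_convex h hb hκ hρ hμ hpos (fun q => hP μ q hμ) x y ht0 ht1
  have h2 := h.envelope_le hb hμ (fun q => hP μ q hμ) x hx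
  have h3 := h.envelope_le hb hμ (fun q => hP μ q hμ) y hy
  simp only [sub_self, norm_zero, ne_eq, OfNat.ofNat_ne_zero, not_false_eq_true, zero_pow,
    mul_zero, add_zero] at h2 h3
  have h4 := mul_le_mul_of_nonneg_left h2 (sub_pos.mpr ht1).le
  have h5 := mul_le_mul_of_nonneg_left h3 ht0.le
  linarith

/-- Limiting second-order subgradients inherit a lower bound from the combined ones. -/
theorem le_inner_of_mem_limitingSecondSubdiff {κ : ℝ}
    (hpos : ∀ x y : E, y ∈ subdifferential φ x → ∀ w : E, ∀ z ∈ combinedSecondSubdiff φ x y w,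
      κ * ‖w‖ ^ 2 ≤ inner ℝ z w)
    {x y w z : E} (hz : z ∈ limitingSecondSubdiff φ x y w) : κ * ‖w‖ ^ 2 ≤ inner ℝ z w := by
  obtain ⟨-, p, u, hp, -, hul, hu⟩ := hz
  have h1 : ∀ k, κ * ‖-(u k).snd‖ ^ 2 ≤ inner ℝ (u k).fst (-(u k).snd) := fun k => by
    refine hpos (p k).fst (p k).snd (hp k) _ _ ?_
    have h2 : WithLp.toLp 2 ((u k).fst, - -(u k).snd) = u k := by rw [neg_neg]; rfl
    change WithLp.toLp 2 ((u k).fst, - -(u k).snd) ∈ regularNormalCone _ (p k)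
    rw [h2]
    exact hu k
  have c1 : Tendsto (fun k => (u k).fst) atTop (𝓝 z) :=
    ((WithLp.continuous_fst 2 E E).tendsto _).comp hul
  have c2 : Tendsto (fun k => -(u k).snd) atTop (𝓝 w) := by
    have := (((WithLp.continuous_snd 2 E E).tendsto _).comp hul).neg
    simpa using this
  exact le_of_tendsto_of_tendsto' ((c2.norm.pow 2).const_mul κ) (c1.inner c2) h1

end Main

end VarAnalysis

theorem mainTheorem8 (n : ℕ) (φ : EuclideanSpace ℝ (Fin n) → EReal)
    (hproper : VarAnalysis.IsProper φ) (hlsc : LowerSemicontinuous φ)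
    (κ : ℝ) (hκ : 0 < κ) :
    List.TFAE [
      VarAnalysis.IsStronglyConvex κ φ,
      VarAnalysis.IsWeaklyConvex φ ∧
        ∀ x y : EuclideanSpace ℝ (Fin n), y ∈ VarAnalysis.subdifferential φ x →
          ∀ w : EuclideanSpace ℝ (Fin n), ∀ z ∈ VarAnalysis.combinedSecondSubdiff φ x y w,
            κ * ‖w‖ ^ 2 ≤ inner ℝ z w,
      VarAnalysis.IsWeaklyConvex φ ∧
        ∀ x y : EuclideanSpace ℝ (Fin n), y ∈ VarAnalysis.subdifferential φ x →
          ∀ w : EuclideanSpace ℝ (Fin n), ∀ z ∈ VarAnalysis.limitingSecondSubdiff φ x y w,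
            κ * ‖w‖ ^ 2 ≤ inner ℝ z w] := by
  tfae_have 1 → 2 := fun h =>
    ⟨⟨1, one_pos, h.2.mono hproper.1 (by linarith)⟩, fun _ _ _ _ _ hz =>
      h.2.le_inner_of_mem_combinedSecondSubdiff hproper hlsc hz⟩
  tfae_have 2 → 1 := fun h =>
    ⟨hκ, VarAnalysis.sConvexOn_of_combinedSecondSubdiff hκ h.1 hproper hlsc h.2⟩
  tfae_have 2 → 3 := fun h =>
    ⟨h.1, fun _ _ _ _ _ hz => VarAnalysis.le_inner_of_mem_limitingSecondSubdiff h.2 hz⟩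
  tfae_have 3 → 2 := fun h =>
    ⟨h.1, fun x y hy w z hz =>
      h.2 x y hy w z (VarAnalysis.regularNormalCone_subset_limitingNormalCone _ _ hz)⟩
  tfae_finish
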